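/- Let $m,n\in\mathbb N$ and let $M_k(\mathbb C)$ denote the complex $k\times k$ matrices. A linear map $\Phi:M_m(\mathbb C)\to M_n(\mathbb C)$ is called a Schwarz map if $\Phi(K^*K)\ge \Phi(K)^*\Phi(K)$ (in the sense that the difference is positive semidefinite) for all $K\in M_m(\mathbb C)$, and unital if $\Phi(\mathbf 1)=\mathbf 1$. Let $\Phi^\dagger:M_n(\mathbb C)\to M_m(\mathbb C)$ denote the adjoint of $\Phi$ with respect to the Hilbert--Schmidt inner products $\langle X,Y\rangle=\operatorname{tr}[X^*Y]$. Let $0<p\le 1$ and let $\Phi:M_m(\mathbb C)\to M_n(\mathbb C)$ be a unital Schwarz map. Then for every positive definite $A\in M_n(\mathbb C)$ and every $B\in M_m(\mathbb C)$, $$\operatorname{tr}\big[(\Phi(B)^*A^p\,\Phi(B))^{1/p}\big]\;\le\;\operatorname{tr}\big[(B^*\,\Phi^\dagger(A)^p\,B)^{1/p}\big],$$ where real powers of positive semidefinite matrices are defined by the functional calculus. -/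

import Mathlib

open scoped Matrix MatrixOrder ComplexOrder

/-- A Schwarz map `Φ : M_m(ℂ) → M_n(ℂ)`: a linear map with `Φ(K^* K) ≥ Φ(K)^* Φ(K)` for all `K`,
where `≥` is the Loewner order. -/
def IsSchwarzMap {m n : ℕ}
    (Φ : Matrix (Fin m) (Fin m) ℂ →ₗ[ℂ] Matrix (Fin n) (Fin n) ℂ) : Prop :=
  ∀ K : Matrix (Fin m) (Fin m) ℂ, (Φ K)ᴴ * Φ K ≤ Φ (Kᴴ * K)

/-- A map is unital if it sends the identity matrix to the identity matrix. -/
def IsUnitalMap {m n : ℕ}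
    (Φ : Matrix (Fin m) (Fin m) ℂ →ₗ[ℂ] Matrix (Fin n) (Fin n) ℂ) : Prop :=
  Φ 1 = 1

/-- The adjoint `Φ^†` of `Φ` for the Hilbert–Schmidt inner products `⟨X, Y⟩ = tr (X^* Y)`.
Its `(i, j)` entry at `Y` is `⟨E_ij, Φ^†(Y)⟩ = ⟨Φ(E_ij), Y⟩`, with `E_ij` the matrix units;
`eq_hsAdjoint_iff` shows that it is the unique map with the defining property of the adjoint. -/
noncomputable def hsAdjoint {m n : ℕ}
    (Φ : Matrix (Fin m) (Fin m) ℂ →ₗ[ℂ] Matrix (Fin n) (Fin n) ℂ) :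
    Matrix (Fin n) (Fin n) ℂ →ₗ[ℂ] Matrix (Fin m) (Fin m) ℂ where
  toFun Y := Matrix.of fun i j => ((Φ (Matrix.single i j 1))ᴴ * Y).trace
  map_add' Y Z := by
    ext i j
    simp [Matrix.mul_add]
  map_smul' c Y := by
    ext i j
    simp

theorem trace_conjTranspose_mul_hsAdjoint {m n : ℕ}
    (Φ : Matrix (Fin m) (Fin m) ℂ →ₗ[ℂ] Matrix (Fin n) (Fin n) ℂ)
    (X : Matrix (Fin m) (Fin m) ℂ) (Y : Matrix (Fin n) (Fin n) ℂ) :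
    (Xᴴ * hsAdjoint Φ Y).trace = ((Φ X)ᴴ * Y).trace := by
  have hX : Φ X = ∑ i, ∑ j, X i j • Φ (Matrix.single i j 1) := by
    conv_lhs => rw [Matrix.matrix_eq_sum_single X]
    simp only [map_sum]
    refine Finset.sum_congr rfl fun i _ => Finset.sum_congr rfl fun j _ => ?_
    rw [← map_smul, Matrix.smul_single, smul_eq_mul, mul_one]
  rw [hX]
  simp only [Matrix.conjTranspose_sum, Matrix.conjTranspose_smul, Matrix.sum_mul,
    Matrix.smul_mul, Matrix.trace_sum, Matrix.trace_smul, smul_eq_mul]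
  rw [Finset.sum_comm]
  simp [Matrix.trace, Matrix.mul_apply, hsAdjoint]

theorem eq_hsAdjoint_iff {m n : ℕ}
    (Φ : Matrix (Fin m) (Fin m) ℂ →ₗ[ℂ] Matrix (Fin n) (Fin n) ℂ)
    (Ψ : Matrix (Fin n) (Fin n) ℂ → Matrix (Fin m) (Fin m) ℂ) :
    Ψ = hsAdjoint Φ ↔ ∀ X Y, (Xᴴ * Ψ Y).trace = ((Φ X)ᴴ * Y).trace := by
  constructor
  · rintro rfl X Y
    exact trace_conjTranspose_mul_hsAdjoint Φ X Y
  · intro h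
    funext Y
    have h0 : ((Ψ Y - hsAdjoint Φ Y)ᴴ * (Ψ Y - hsAdjoint Φ Y)).trace = 0 := by
      rw [Matrix.mul_sub, Matrix.trace_sub, h, trace_conjTranspose_mul_hsAdjoint, sub_self]
    exact sub_eq_zero.mp (Matrix.trace_conjTranspose_mul_self_eq_zero_iff.mp h0)

/-! For `0 < p < 1`, `x ^ p * z ^ (1 - p)` is a positive multiple of the integral of
`t ^ (p - 2) * (x : t z)` over `t > 0`, where `a : b` is the parallel sum, and the parallel sum of
two quadratic forms is their infimal convolution. Hence Lieb's functional
`tr (B* A ^ p B Z ^ (1 - p))` inherits monotonicity under a Schwarz map `Φ` from the endpoints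
`p = 0` and `p = 1`, where it is the Schwarz inequality for `B` paired with `Z` and for `B*` paired
with `A`. Apply it with `Z = (Φ(B)* A ^ p Φ(B)) ^ (1 / p)`, so that the left side is `tr Z`, and
bound the right side by Young's trace inequality. Since every Schwarz map satisfies `Φ 1 ≤ 1`, one
has `tr Φ†(Z) ≤ tr Z`, and the term `(1 - p) tr Z` is absorbed. -/

section ParallelSum

open MeasureTheory Set

/-- The parallel sum `a : b = (a⁻¹ + b⁻¹)⁻¹` of nonnegative reals, written so that it is `0` when
`a = 0` or `b = 0`. -/
noncomputable def parallelSum (a b : ℝ) : ℝ := a * b / (a + b)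

theorem parallelSum_mul_norm_add_sq_le {E : Type*} [SeminormedAddGroup E] {a b : ℝ} (ha : 0 ≤ a)
    (hb : 0 ≤ b) (u v : E) :
    parallelSum a b * ‖u + v‖ ^ 2 ≤ a * ‖u‖ ^ 2 + b * ‖v‖ ^ 2 := by
  rcases (add_nonneg ha hb).eq_or_lt with h | h
  · rw [parallelSum, ← h, div_zero, zero_mul]
    positivity
  · calc parallelSum a b * ‖u + v‖ ^ 2 ≤ parallelSum a b * (‖u‖ + ‖v‖) ^ 2 := by
          unfold parallelSum
          gcongr
          exact norm_add_le u v
      _ ≤ a * ‖u‖ ^ 2 + b * ‖v‖ ^ 2 := by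
          rw [parallelSum, div_mul_eq_mul_div, div_le_iff₀ h]
          nlinarith [sq_nonneg (a * ‖u‖ - b * ‖v‖)]

theorem exists_add_eq_and_parallelSum_mul_norm_sq_eq {E : Type*} [SeminormedAddCommGroup E]
    [NormedSpace ℝ E] {a b : ℝ} (ha : 0 ≤ a) (hb : 0 ≤ b) (y : E) :
    ∃ u v, u + v = y ∧ a * ‖u‖ ^ 2 + b * ‖v‖ ^ 2 = parallelSum a b * ‖y‖ ^ 2 := by
  rcases (add_nonneg ha hb).eq_or_lt with h | h
  · obtain ⟨rfl, rfl⟩ := (add_eq_zero_iff_of_nonneg ha hb).1 h.symm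
    exact ⟨0, y, zero_add y, by simp [parallelSum]⟩
  · refine ⟨(b / (a + b)) • y, (a / (a + b)) • y, ?_, ?_⟩
    · rw [← add_smul, ← add_div, add_comm b, div_self h.ne', one_smul]
    · simp only [norm_smul, mul_pow, Real.norm_eq_abs, sq_abs, parallelSum]
      field_simp
      ring

variable {p a b : ℝ}

theorem rpowIntegrand₀₁_div_mul_eq (hp : p ∈ Ioo (0 : ℝ) 1) (ha : 0 ≤ a) (hb : 0 ≤ b) {t : ℝ}
    (ht : 0 < t) :
    Real.rpowIntegrand₀₁ p t (a / b) * b = t ^ (p - 2) * parallelSum a (t * b) := by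
  rw [Real.rpowIntegrand₀₁_eq_pow_div hp ht.le (div_nonneg ha hb), parallelSum]
  rcases hb.eq_or_lt with rfl | hb
  · simp
  · have hpow : t ^ (p - 1) = t ^ (p - 2) * t := by
      rw [← Real.rpow_add_one ht.ne']
      ring_nf
    have hsum : t + a / b = (a + t * b) / b := by
      field_simp
      ring
    rw [hpow, hsum]
    field_simp

theorem integrableOn_rpow_mul_parallelSum (hp : p ∈ Ioo (0 : ℝ) 1) (ha : 0 ≤ a) (hb : 0 ≤ b) :
    IntegrableOn (fun t => t ^ (p - 2) * parallelSum a (t * b)) (Ioi 0) :=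
  IntegrableOn.congr_fun
    ((Real.integrableOn_rpowIntegrand₀₁_Ioi hp (div_nonneg ha hb)).mul_const b)
    (fun _ ht => rpowIntegrand₀₁_div_mul_eq hp ha hb ht) measurableSet_Ioi

theorem integral_rpow_mul_parallelSum (hp : p ∈ Ioo (0 : ℝ) 1) (ha : 0 ≤ a) (hb : 0 ≤ b) :
    ∫ t in Ioi 0, t ^ (p - 2) * parallelSum a (t * b) =
      a ^ p * b ^ (1 - p) * ∫ t in Ioi 0, Real.rpowIntegrand₀₁ p t 1 := by
  rw [← setIntegral_congr_fun measurableSet_Ioi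
      fun _ ht => rpowIntegrand₀₁_div_mul_eq hp ha hb ht,
    integral_mul_const, Real.integral_rpowIntegrand₀₁_eq_rpow_mul_const hp (div_nonneg ha hb),
    mul_right_comm]
  congr 1
  rcases hb.eq_or_lt with rfl | hb
  · simp [Real.zero_rpow (sub_pos.2 hp.2).ne']
  · rw [Real.div_rpow ha hb.le, Real.rpow_sub hb, Real.rpow_one, div_mul_eq_mul_div, mul_div_assoc]

end ParallelSum

section TraceOrder

open Matrix

variable {𝕜 n : Type*} [RCLike 𝕜] [Fintype n]

theorem trace_mul_nonneg_of_posSemidef {X Y : Matrix n n 𝕜} (hX : X.PosSemidef)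
    (hY : Y.PosSemidef) : 0 ≤ (X * Y).trace := by
  classical
  obtain ⟨C, rfl⟩ := CStarAlgebra.nonneg_iff_eq_star_mul_self.1 hY.nonneg
  rw [← mul_assoc, trace_mul_comm, ← mul_assoc, star_eq_conjTranspose]
  exact (hX.mul_mul_conjTranspose_same C).trace_nonneg

theorem trace_mul_le_trace_mul_of_le {X Y Z : Matrix n n 𝕜} (h : X ≤ Y) (hZ : Z.PosSemidef) :
    (X * Z).trace ≤ (Y * Z).trace := by
  rw [← sub_nonneg, ← trace_sub, ← sub_mul]
  exact trace_mul_nonneg_of_posSemidef h hZ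

theorem posSemidef_rpow [DecidableEq n] (X : Matrix n n 𝕜) (r : ℝ) : (X ^ r).PosSemidef :=
  nonneg_iff_posSemidef.1 CFC.rpow_nonneg

theorem posSemidef_of_forall_trace_mul_nonneg {Y : Matrix n n ℂ}
    (h : ∀ X : Matrix n n ℂ, X.PosSemidef → 0 ≤ (X * Y).trace) : Y.PosSemidef := by
  classical
  rw [← isPositive_toEuclideanLin_iff, LinearMap.isPositive_iff_complex]
  intro x
  have hx := h _ (posSemidef_vecMulVec_self_star x.ofLp)
  rw [vecMulVec_mul, trace_vecMulVec, dotProduct_comm, ← dotProduct_mulVec] at hx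
  have hinner : inner ℂ (toEuclideanLin Y x) x = star (star x.ofLp ⬝ᵥ Y *ᵥ x.ofLp) := by
    rw [EuclideanSpace.inner_eq_star_dotProduct, ← star_dotProduct_star, star_star,
      dotProduct_comm]
    rfl
  have hreal := Complex.nonneg_iff.1 (hinner ▸ star_nonneg_iff.2 hx)
  exact ⟨Complex.ext rfl hreal.2, hreal.1⟩

end TraceOrder

theorem rpow_mul_rpow_of_exponent_nonneg {A : Type*} [PartialOrder A] [Ring A] [StarRing A]
    [TopologicalSpace A] [StarOrderedRing A] [Algebra ℝ A]
    [ContinuousFunctionalCalculus ℝ A IsSelfAdjoint] [NonnegSpectrumClass ℝ A]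
    (a : A) {x y : ℝ} (hx : 0 ≤ x) (hy : 0 ≤ y) : a ^ x * a ^ y = a ^ (x + y) := by
  simp only [CFC.rpow_def]
  rw [← cfc_mul (fun z : NNReal => z ^ x) (fun z => z ^ y) a
    (NNReal.continuous_rpow_const hx).continuousOn (NNReal.continuous_rpow_const hy).continuousOn]
  exact cfc_congr fun z _ => (NNReal.rpow_add_of_nonneg z hx hy).symm

section DoubleSpectralForm

open Matrix

variable {𝕜 m n : Type*} [RCLike 𝕜] [Fintype m] [DecidableEq m] [Fintype n] [DecidableEq n]
  {A : Matrix n n 𝕜} {Z : Matrix m m 𝕜}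

/-- The entries of a rectangular matrix relative to the eigenbases of two Hermitian matrices. -/
noncomputable def eigenCoeff (hA : A.IsHermitian) (hZ : Z.IsHermitian) :
    Matrix n m 𝕜 ≃ₗ[𝕜] Matrix n m 𝕜 where
  toFun C := (hA.eigenvectorUnitary : Matrix n n 𝕜)ᴴ * C * (hZ.eigenvectorUnitary : Matrix m m 𝕜)
  invFun D := (hA.eigenvectorUnitary : Matrix n n 𝕜) * D * (hZ.eigenvectorUnitary : Matrix m m 𝕜)ᴴ
  map_add' C D := by rw [Matrix.mul_add, Matrix.add_mul]
  map_smul' c C := by simp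
  left_inv C := by
    have hU := Unitary.mul_star_self_of_mem hA.eigenvectorUnitary.2
    have hV := Unitary.mul_star_self_of_mem hZ.eigenvectorUnitary.2
    rw [star_eq_conjTranspose] at hU hV
    simp only [Matrix.mul_assoc, hV, Matrix.mul_one]
    rw [← Matrix.mul_assoc, hU, Matrix.one_mul]
  right_inv D := by
    have hU := Unitary.star_mul_self_of_mem hA.eigenvectorUnitary.2
    have hV := Unitary.star_mul_self_of_mem hZ.eigenvectorUnitary.2
    rw [star_eq_conjTranspose] at hU hV
    simp only [Matrix.mul_assoc, hV, Matrix.mul_one]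
    rw [← Matrix.mul_assoc, hU, Matrix.one_mul]

/-- The quadratic form on rectangular matrices `C` of the function `φ` of the commuting operators
"multiply by `A` on the left" and "multiply by `Z` on the right". -/
noncomputable def doubleSpectralForm (hA : A.IsHermitian) (hZ : Z.IsHermitian) (φ : ℝ → ℝ → ℝ)
    (C : Matrix n m 𝕜) : ℝ :=
  ∑ i, ∑ j, φ (hA.eigenvalues i) (hZ.eigenvalues j) * ‖eigenCoeff hA hZ C i j‖ ^ 2

theorem trace_conjTranspose_mul_diagonal_mul_mul_diagonal (f : n → ℝ) (g : m → ℝ)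
    (C : Matrix n m 𝕜) :
    (Cᴴ * diagonal (fun i => (f i : 𝕜)) * C * diagonal (fun j => (g j : 𝕜))).trace =
      ((∑ i, ∑ j, f i * g j * ‖C i j‖ ^ 2 : ℝ) : 𝕜) := by
  rw [Finset.sum_comm, Matrix.mul_assoc, Matrix.mul_assoc]
  push_cast
  refine Finset.sum_congr rfl fun j _ => ?_
  rw [diag_apply, Matrix.mul_apply]
  refine Finset.sum_congr rfl fun i _ => ?_
  rw [diagonal_mul, mul_diagonal, conjTranspose_apply, ← RCLike.mul_conj, RCLike.star_def]
  ring

theorem trace_conjTranspose_mul_cfc_mul_mul_cfc (hA : A.IsHermitian) (hZ : Z.IsHermitian)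
    (f g : ℝ → ℝ) (C : Matrix n m 𝕜) :
    (Cᴴ * cfc f A * C * cfc g Z).trace =
      (doubleSpectralForm hA hZ (fun x y => f x * g y) C : 𝕜) := by
  rw [doubleSpectralForm, ← trace_conjTranspose_mul_diagonal_mul_mul_diagonal
    (fun i => f (hA.eigenvalues i)) (fun j => g (hZ.eigenvalues j)) (eigenCoeff hA hZ C),
    hA.cfc_eq, hZ.cfc_eq, IsHermitian.cfc, IsHermitian.cfc, Unitary.conjStarAlgAut_apply,
    Unitary.conjStarAlgAut_apply, eigenCoeff]
  simp only [LinearEquiv.coe_mk, LinearMap.coe_mk, AddHom.coe_mk, conjTranspose_mul,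
    conjTranspose_conjTranspose, star_eq_conjTranspose]
  rw [← Matrix.mul_assoc, ← Matrix.mul_assoc, trace_mul_comm]
  simp only [Matrix.mul_assoc]
  rfl

theorem trace_conjTranspose_mul_rpow_mul_mul_rpow (hA : A.PosSemidef) (hZ : Z.PosSemidef)
    (r s : ℝ) (C : Matrix n m 𝕜) :
    (Cᴴ * A ^ r * C * Z ^ s).trace =
      (doubleSpectralForm hA.1 hZ.1 (fun x y => x ^ r * y ^ s) C : 𝕜) := by
  rw [CFC.rpow_eq_cfc_real hA.nonneg, CFC.rpow_eq_cfc_real hZ.nonneg,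
    trace_conjTranspose_mul_cfc_mul_mul_cfc hA.1 hZ.1]

theorem trace_conjTranspose_mul_mul_self (hA : A.PosSemidef) (hZ : Z.PosSemidef)
    (C : Matrix n m 𝕜) :
    (Cᴴ * A * C).trace = (doubleSpectralForm hA.1 hZ.1 (fun x _ => x) C : 𝕜) := by
  simpa [CFC.rpow_one A hA.nonneg, CFC.rpow_zero Z hZ.nonneg] using
    trace_conjTranspose_mul_rpow_mul_mul_rpow hA hZ 1 0 C

theorem trace_conjTranspose_mul_self_mul (hA : A.PosSemidef) (hZ : Z.PosSemidef)
    (C : Matrix n m 𝕜) :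
    (Cᴴ * C * Z).trace = (doubleSpectralForm hA.1 hZ.1 (fun _ y => y) C : 𝕜) := by
  simpa [CFC.rpow_zero A hA.nonneg, CFC.rpow_one Z hZ.nonneg] using
    trace_conjTranspose_mul_rpow_mul_mul_rpow hA hZ 0 1 C

variable (hA : A.IsHermitian) (hZ : Z.IsHermitian) {φ ψ : ℝ → ℝ → ℝ} (C : Matrix n m 𝕜)

theorem doubleSpectralForm_mono
    (h : ∀ i j, φ (hA.eigenvalues i) (hZ.eigenvalues j) ≤
      ψ (hA.eigenvalues i) (hZ.eigenvalues j)) :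
    doubleSpectralForm hA hZ φ C ≤ doubleSpectralForm hA hZ ψ C :=
  Finset.sum_le_sum fun i _ => Finset.sum_le_sum fun j _ =>
    mul_le_mul_of_nonneg_right (h i j) (sq_nonneg _)

variable (φ ψ) in
theorem doubleSpectralForm_add :
    doubleSpectralForm hA hZ (fun x y => φ x y + ψ x y) C =
      doubleSpectralForm hA hZ φ C + doubleSpectralForm hA hZ ψ C := by
  simp only [doubleSpectralForm, add_mul, Finset.sum_add_distrib]

variable (φ) in
theorem doubleSpectralForm_const_mul (r : ℝ) :
    doubleSpectralForm hA hZ (fun x y => r * φ x y) C = r * doubleSpectralForm hA hZ φ C := by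
  simp only [doubleSpectralForm, Finset.mul_sum, mul_assoc]

theorem doubleSpectralForm_parallelSum_add_le
    (hφ : ∀ i j, 0 ≤ φ (hA.eigenvalues i) (hZ.eigenvalues j))
    (hψ : ∀ i j, 0 ≤ ψ (hA.eigenvalues i) (hZ.eigenvalues j)) (U W : Matrix n m 𝕜) :
    doubleSpectralForm hA hZ (fun x y => parallelSum (φ x y) (ψ x y)) (U + W) ≤
      doubleSpectralForm hA hZ φ U + doubleSpectralForm hA hZ ψ W := by
  simp only [doubleSpectralForm, ← Finset.sum_add_distrib, map_add, Matrix.add_apply]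
  exact Finset.sum_le_sum fun i _ => Finset.sum_le_sum fun j _ =>
    parallelSum_mul_norm_add_sq_le (hφ i j) (hψ i j) _ _

theorem exists_add_eq_and_doubleSpectralForm_parallelSum_eq
    (hφ : ∀ i j, 0 ≤ φ (hA.eigenvalues i) (hZ.eigenvalues j))
    (hψ : ∀ i j, 0 ≤ ψ (hA.eigenvalues i) (hZ.eigenvalues j)) :
    ∃ U W, U + W = C ∧ doubleSpectralForm hA hZ φ U + doubleSpectralForm hA hZ ψ W =
      doubleSpectralForm hA hZ (fun x y => parallelSum (φ x y) (ψ x y)) C := by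
  choose u v huv hmin using fun i j =>
    exists_add_eq_and_parallelSum_mul_norm_sq_eq (hφ i j) (hψ i j) (eigenCoeff hA hZ C i j)
  refine ⟨(eigenCoeff hA hZ).symm (of u), (eigenCoeff hA hZ).symm (of v), ?_, ?_⟩
  · rw [← map_add, LinearEquiv.symm_apply_eq]
    ext i j
    exact huv i j
  · simp only [doubleSpectralForm, LinearEquiv.apply_symm_apply, of_apply,
      ← Finset.sum_add_distrib, hmin]

end DoubleSpectralForm

section Interpolation

open Matrix MeasureTheory Set

variable {𝕜 m n m' n' : Type*} [RCLike 𝕜] [Fintype m] [DecidableEq m] [Fintype n] [DecidableEq n]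
  [Fintype m'] [DecidableEq m'] [Fintype n'] [DecidableEq n']
  {A : Matrix n n 𝕜} {Z : Matrix m m 𝕜} {A' : Matrix n' n' 𝕜} {Z' : Matrix m' m' 𝕜} {p : ℝ}

theorem integrableOn_doubleSpectralForm_parallelSum (hp : p ∈ Ioo (0 : ℝ) 1) (hA : A.PosSemidef)
    (hZ : Z.PosSemidef) (C : Matrix n m 𝕜) :
    IntegrableOn (fun t => t ^ (p - 2) *
      doubleSpectralForm hA.1 hZ.1 (fun x y => parallelSum x (t * y)) C) (Ioi 0) := by
  simp only [doubleSpectralForm, Finset.mul_sum, ← mul_assoc]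
  exact integrable_finsetSum _ fun i _ => integrable_finsetSum _ fun j _ =>
    (integrableOn_rpow_mul_parallelSum hp (hA.eigenvalues_nonneg i)
      (hZ.eigenvalues_nonneg j)).mul_const _

theorem integral_doubleSpectralForm_parallelSum (hp : p ∈ Ioo (0 : ℝ) 1) (hA : A.PosSemidef)
    (hZ : Z.PosSemidef) (C : Matrix n m 𝕜) :
    ∫ t in Ioi 0, t ^ (p - 2) *
        doubleSpectralForm hA.1 hZ.1 (fun x y => parallelSum x (t * y)) C =
      doubleSpectralForm hA.1 hZ.1 (fun x y => x ^ p * y ^ (1 - p)) C *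
        ∫ t in Ioi 0, Real.rpowIntegrand₀₁ p t 1 := by
  have hint (i : n) (j : m) := (integrableOn_rpow_mul_parallelSum hp (hA.eigenvalues_nonneg i)
    (hZ.eigenvalues_nonneg j)).mul_const (‖eigenCoeff hA.1 hZ.1 C i j‖ ^ 2)
  simp only [doubleSpectralForm, Finset.mul_sum, Finset.sum_mul, ← mul_assoc]
  rw [integral_finsetSum _ fun i _ => integrable_finsetSum _ fun j _ => hint i j]
  refine Finset.sum_congr rfl fun i _ => ?_
  rw [integral_finsetSum _ fun j _ => hint i j]
  refine Finset.sum_congr rfl fun j _ => ?_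
  rw [integral_mul_const, integral_rpow_mul_parallelSum hp (hA.eigenvalues_nonneg i)
    (hZ.eigenvalues_nonneg j), mul_right_comm]

theorem doubleSpectralForm_parallelSum_map_le
    (T : Matrix n' m' 𝕜 →+ Matrix n m 𝕜) (hA : A.PosSemidef) (hZ : Z.PosSemidef)
    (hA' : A'.PosSemidef) (hZ' : Z'.PosSemidef)
    (hleft : ∀ U, ((T U)ᴴ * A * T U).trace ≤ (Uᴴ * A' * U).trace)
    (hright : ∀ W, ((T W)ᴴ * T W * Z).trace ≤ (Wᴴ * W * Z').trace) {t : ℝ} (ht : 0 ≤ t)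
    (C : Matrix n' m' 𝕜) :
    doubleSpectralForm hA.1 hZ.1 (fun x y => parallelSum x (t * y)) (T C) ≤
      doubleSpectralForm hA'.1 hZ'.1 (fun x y => parallelSum x (t * y)) C := by
  obtain ⟨U, W, rfl, hUW⟩ := exists_add_eq_and_doubleSpectralForm_parallelSum_eq hA'.1 hZ'.1
    (φ := fun x _ => x) (ψ := fun _ y => t * y) C (fun i _ => hA'.eigenvalues_nonneg i)
    (fun _ j => mul_nonneg ht (hZ'.eigenvalues_nonneg j))
  have hU := hleft U
  have hW := hright W
  rw [trace_conjTranspose_mul_mul_self hA hZ, trace_conjTranspose_mul_mul_self hA' hZ',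
    RCLike.ofReal_le_ofReal] at hU
  rw [trace_conjTranspose_mul_self_mul hA hZ, trace_conjTranspose_mul_self_mul hA' hZ',
    RCLike.ofReal_le_ofReal] at hW
  calc doubleSpectralForm hA.1 hZ.1 (fun x y => parallelSum x (t * y)) (T (U + W))
    _ ≤ doubleSpectralForm hA.1 hZ.1 (fun x _ => x) (T U) +
          doubleSpectralForm hA.1 hZ.1 (fun _ y => t * y) (T W) := by
      rw [map_add]
      exact doubleSpectralForm_parallelSum_add_le hA.1 hZ.1 (φ := fun x _ => x)
        (ψ := fun _ y => t * y) (fun i _ => hA.eigenvalues_nonneg i)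
        (fun _ j => mul_nonneg ht (hZ.eigenvalues_nonneg j)) (T U) (T W)
    _ ≤ doubleSpectralForm hA'.1 hZ'.1 (fun x _ => x) U +
          doubleSpectralForm hA'.1 hZ'.1 (fun _ y => t * y) W := by
      rw [doubleSpectralForm_const_mul hA.1 hZ.1 (fun _ y => y),
        doubleSpectralForm_const_mul hA'.1 hZ'.1 (fun _ y => y)]
      gcongr
    _ = doubleSpectralForm hA'.1 hZ'.1 (fun x y => parallelSum x (t * y)) (U + W) := hUW

theorem trace_rpow_mul_rpow_map_le
    (T : Matrix n' m' 𝕜 →+ Matrix n m 𝕜) (hA : A.PosSemidef) (hZ : Z.PosSemidef)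
    (hA' : A'.PosSemidef) (hZ' : Z'.PosSemidef)
    (hleft : ∀ U, ((T U)ᴴ * A * T U).trace ≤ (Uᴴ * A' * U).trace)
    (hright : ∀ W, ((T W)ᴴ * T W * Z).trace ≤ (Wᴴ * W * Z').trace)
    (hp : p ∈ Icc (0 : ℝ) 1) (C : Matrix n' m' 𝕜) :
    ((T C)ᴴ * A ^ p * T C * Z ^ (1 - p)).trace ≤ (Cᴴ * A' ^ p * C * Z' ^ (1 - p)).trace := by
  rcases hp.1.eq_or_lt with rfl | hp0
  · simpa [CFC.rpow_zero A hA.nonneg, CFC.rpow_zero A' hA'.nonneg, CFC.rpow_one Z hZ.nonneg,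
      CFC.rpow_one Z' hZ'.nonneg] using hright C
  rcases hp.2.eq_or_lt with rfl | hp1
  · simpa [CFC.rpow_one A hA.nonneg, CFC.rpow_one A' hA'.nonneg, CFC.rpow_zero Z hZ.nonneg,
      CFC.rpow_zero Z' hZ'.nonneg] using hleft C
  have hp' : p ∈ Ioo (0 : ℝ) 1 := ⟨hp0, hp1⟩
  rw [trace_conjTranspose_mul_rpow_mul_mul_rpow hA hZ,
    trace_conjTranspose_mul_rpow_mul_mul_rpow hA' hZ', RCLike.ofReal_le_ofReal]
  refine le_of_mul_le_mul_right ?_ (Real.integral_rpowIntegrand₀₁_one_pos hp')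
  rw [← integral_doubleSpectralForm_parallelSum hp' hA hZ,
    ← integral_doubleSpectralForm_parallelSum hp' hA' hZ']
  refine setIntegral_mono_on (integrableOn_doubleSpectralForm_parallelSum hp' hA hZ _)
    (integrableOn_doubleSpectralForm_parallelSum hp' hA' hZ' _) measurableSet_Ioi
    fun t (ht : 0 < t) => ?_
  gcongr
  exact doubleSpectralForm_parallelSum_map_le T hA hZ hA' hZ' hleft hright ht.le C

end Interpolation

section Young

open Matrix

variable {𝕜 n : Type*} [RCLike 𝕜] [Fintype n] [DecidableEq n]

theorem mul_rpow_one_sub_le_add {p x z : ℝ} (hp0 : 0 < p) (hp1 : p ≤ 1) (hx : 0 ≤ x)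
    (hz : 0 ≤ z) : x * z ^ (1 - p) ≤ p * x ^ (1 / p) + (1 - p) * z := by
  simpa only [← Real.rpow_mul hx, one_div_mul_cancel hp0.ne', Real.rpow_one] using
    Real.geom_mean_le_arith_mean2_weighted hp0.le (sub_nonneg.2 hp1)
      (Real.rpow_nonneg hx (1 / p)) hz (add_sub_cancel p 1)

theorem trace_mul_rpow_one_sub_le_add {X Z : Matrix n n 𝕜} (hX : X.PosSemidef)
    (hZ : Z.PosSemidef) {p : ℝ} (hp0 : 0 < p) (hp1 : p ≤ 1) :
    (X * Z ^ (1 - p)).trace ≤ p * (X ^ (1 / p)).trace + (1 - p) * Z.trace := by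
  have hXZ := trace_conjTranspose_mul_cfc_mul_mul_cfc hX.1 hZ.1 id (fun z => z ^ (1 - p)) 1
  have hXp := trace_conjTranspose_mul_rpow_mul_mul_rpow hX hZ (1 / p) 0 1
  have hZ1 := trace_conjTranspose_mul_self_mul hX hZ 1
  rw [cfc_id ℝ X hX.1.isSelfAdjoint, ← CFC.rpow_eq_cfc_real hZ.nonneg] at hXZ
  simp only [conjTranspose_one, Matrix.one_mul, CFC.rpow_zero Z hZ.nonneg,
    Real.rpow_zero, mul_one, id] at hXZ hXp hZ1
  rw [hXZ, hXp, hZ1]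
  norm_cast
  rw [← doubleSpectralForm_const_mul, ← doubleSpectralForm_const_mul, ← doubleSpectralForm_add]
  exact doubleSpectralForm_mono hX.1 hZ.1 1 fun i j =>
    mul_rpow_one_sub_le_add hp0 hp1 (hX.eigenvalues_nonneg i) (hZ.eigenvalues_nonneg j)

end Young

section Schwarz

open Matrix

variable {m n : ℕ} {Φ : Matrix (Fin m) (Fin m) ℂ →ₗ[ℂ] Matrix (Fin n) (Fin n) ℂ}
  {A : Matrix (Fin n) (Fin n) ℂ}

theorem IsSchwarzMap.map_nonneg (hΦ : IsSchwarzMap Φ) {X : Matrix (Fin m) (Fin m) ℂ}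
    (hX : 0 ≤ X) : 0 ≤ Φ X := by
  obtain ⟨K, rfl⟩ := CStarAlgebra.nonneg_iff_eq_star_mul_self.1 hX
  exact (posSemidef_conjTranspose_mul_self (Φ K)).nonneg.trans (hΦ K)

theorem IsSchwarzMap.map_conjTranspose (hΦ : IsSchwarzMap Φ) (K : Matrix (Fin m) (Fin m) ℂ) :
    Φ Kᴴ = (Φ K)ᴴ :=
  map_star (PositiveLinearMap.mk₀ Φ fun _ => hΦ.map_nonneg) K

theorem IsSchwarzMap.map_one_le_one (hΦ : IsSchwarzMap Φ) : Φ 1 ≤ 1 := by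
  have hself : (Φ 1)ᴴ = Φ 1 := by rw [← hΦ.map_conjTranspose, conjTranspose_one]
  have hsq : Φ 1 * Φ 1 ≤ Φ 1 := by simpa [hself] using hΦ 1
  rw [← sub_nonneg]
  calc 0 ≤ (1 - Φ 1)ᴴ * (1 - Φ 1) := (posSemidef_conjTranspose_mul_self _).nonneg
    _ = 1 - Φ 1 - (Φ 1 - Φ 1 * Φ 1) := by
      rw [conjTranspose_sub, conjTranspose_one, hself]
      noncomm_ring
    _ ≤ 1 - Φ 1 := sub_le_self _ (sub_nonneg.2 hsq)

theorem IsSchwarzMap.trace_mul_hsAdjoint (hΦ : IsSchwarzMap Φ) (X : Matrix (Fin m) (Fin m) ℂ)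
    (Y : Matrix (Fin n) (Fin n) ℂ) : (X * hsAdjoint Φ Y).trace = (Φ X * Y).trace := by
  simpa [hΦ.map_conjTranspose] using trace_conjTranspose_mul_hsAdjoint Φ Xᴴ Y

theorem IsSchwarzMap.posSemidef_hsAdjoint (hΦ : IsSchwarzMap Φ) (hA : A.PosSemidef) :
    (hsAdjoint Φ A).PosSemidef :=
  posSemidef_of_forall_trace_mul_nonneg fun X hX => by
    rw [hΦ.trace_mul_hsAdjoint]
    exact trace_mul_nonneg_of_posSemidef (hΦ.map_nonneg hX.nonneg).posSemidef hA

theorem IsSchwarzMap.trace_hsAdjoint_le (hΦ : IsSchwarzMap Φ) (hA : A.PosSemidef) :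
    (hsAdjoint Φ A).trace ≤ A.trace := by
  calc (hsAdjoint Φ A).trace = (Φ 1 * A).trace := by
        rw [← hΦ.trace_mul_hsAdjoint, Matrix.one_mul]
    _ ≤ (1 * A).trace := trace_mul_le_trace_mul_of_le hΦ.map_one_le_one hA
    _ = A.trace := by rw [Matrix.one_mul]

theorem IsSchwarzMap.trace_conjTranspose_mul_self_mul_le (hΦ : IsSchwarzMap Φ)
    (hA : A.PosSemidef) (K : Matrix (Fin m) (Fin m) ℂ) :
    ((Φ K)ᴴ * Φ K * A).trace ≤ (Kᴴ * K * hsAdjoint Φ A).trace := by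
  rw [hΦ.trace_mul_hsAdjoint]
  exact trace_mul_le_trace_mul_of_le (hΦ K) hA

theorem IsSchwarzMap.trace_conjTranspose_mul_mul_self_le (hΦ : IsSchwarzMap Φ)
    (hA : A.PosSemidef) (K : Matrix (Fin m) (Fin m) ℂ) :
    ((Φ K)ᴴ * A * Φ K).trace ≤ (Kᴴ * hsAdjoint Φ A * K).trace := by
  rw [trace_mul_cycle, trace_mul_cycle Kᴴ]
  simpa [hΦ.map_conjTranspose] using hΦ.trace_conjTranspose_mul_self_mul_le hA Kᴴ

theorem IsSchwarzMap.trace_rpow_mul_rpow_le (hΦ : IsSchwarzMap Φ)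
    {Z : Matrix (Fin n) (Fin n) ℂ} (hA : A.PosSemidef) (hZ : Z.PosSemidef) {p : ℝ}
    (hp : p ∈ Set.Icc (0 : ℝ) 1) (B : Matrix (Fin m) (Fin m) ℂ) :
    ((Φ B)ᴴ * A ^ p * Φ B * Z ^ (1 - p)).trace ≤
      (Bᴴ * (hsAdjoint Φ A) ^ p * B * (hsAdjoint Φ Z) ^ (1 - p)).trace :=
  trace_rpow_mul_rpow_map_le Φ.toAddMonoidHom hA hZ (hΦ.posSemidef_hsAdjoint hA)
    (hΦ.posSemidef_hsAdjoint hZ) (hΦ.trace_conjTranspose_mul_mul_self_le hA)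
    (hΦ.trace_conjTranspose_mul_self_mul_le hZ) hp B

end Schwarz

theorem theorem1p6_general {m n : ℕ} {p : ℝ} (hp0 : 0 < p) (hp1 : p ≤ 1)
    {Φ : Matrix (Fin m) (Fin m) ℂ →ₗ[ℂ] Matrix (Fin n) (Fin n) ℂ} (hΦ : IsSchwarzMap Φ)
    {A : Matrix (Fin n) (Fin n) ℂ} (hA : A.PosSemidef) (B : Matrix (Fin m) (Fin m) ℂ) :
    (((Φ B)ᴴ * A ^ p * Φ B) ^ (1 / p)).trace ≤
      ((Bᴴ * (hsAdjoint Φ A) ^ p * B) ^ (1 / p)).trace := by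
  have hX : ((Φ B)ᴴ * A ^ p * Φ B).PosSemidef :=
    (posSemidef_rpow _ p).conjTranspose_mul_mul_same _
  have hX' : (Bᴴ * (hsAdjoint Φ A) ^ p * B).PosSemidef :=
    (posSemidef_rpow _ p).conjTranspose_mul_mul_same _
  set X := (Φ B)ᴴ * A ^ p * Φ B
  set X' := Bᴴ * (hsAdjoint Φ A) ^ p * B
  set Z := X ^ (1 / p)
  have hZ : Z.PosSemidef := posSemidef_rpow _ _
  have hXZ : X = Z ^ p := by
    rw [CFC.rpow_rpow_of_exponent_nonneg X _ _ (by positivity) hp0.le hX.nonneg,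
      one_div_mul_cancel hp0.ne', CFC.rpow_one X hX.nonneg]
  have htrace : Z.trace ≤ p * (X' ^ (1 / p)).trace + (1 - p) * Z.trace := calc
    Z.trace = (X * Z ^ (1 - p)).trace := by
      rw [hXZ, rpow_mul_rpow_of_exponent_nonneg Z hp0.le (sub_nonneg.2 hp1),
        add_sub_cancel, CFC.rpow_one Z hZ.nonneg]
    _ ≤ (X' * (hsAdjoint Φ Z) ^ (1 - p)).trace := hΦ.trace_rpow_mul_rpow_le hA hZ ⟨hp0.le, hp1⟩ B
    _ ≤ p * (X' ^ (1 / p)).trace + (1 - p) * (hsAdjoint Φ Z).trace :=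
      trace_mul_rpow_one_sub_le_add hX' (hΦ.posSemidef_hsAdjoint hZ) hp0 hp1
    _ ≤ p * (X' ^ (1 / p)).trace + (1 - p) * Z.trace := by
      gcongr
      · exact_mod_cast sub_nonneg.2 hp1
      · exact hΦ.trace_hsAdjoint_le hZ
  refine le_of_mul_le_mul_left ?_ (Complex.zero_lt_real.2 hp0)
  rw [sub_mul, one_mul, add_sub_left_comm, le_add_iff_nonneg_right, sub_nonneg] at htrace
  exact htrace

/-- Real powers are those of the continuous functional calculus for positive semidefinite matrices.
The inequality is in the order of `ℂ`: the traces have equal imaginary parts (both are real) and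
their real parts satisfy the inequality. -/
theorem theorem1p6 (m n : ℕ) (p : ℝ) (hp0 : 0 < p) (hp1 : p ≤ 1)
    (Φ : Matrix (Fin m) (Fin m) ℂ →ₗ[ℂ] Matrix (Fin n) (Fin n) ℂ)
    (hΦ : IsSchwarzMap Φ) (hΦ1 : IsUnitalMap Φ)
    (A : Matrix (Fin n) (Fin n) ℂ) (hA : A.PosDef)
    (B : Matrix (Fin m) (Fin m) ℂ) :
    (((Φ B)ᴴ * A ^ p * Φ B) ^ (1 / p)).trace ≤ ((Bᴴ * (hsAdjoint Φ A) ^ p * B) ^ (1 / p)).trace := by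
  exact theorem1p6_general hp0 hp1 hΦ hA.posSemidef B
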